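/- Let $n \ge 1$ and $k \ge 0$ be integers. A rooted tree labeled by $[n] = \{1, \dots, n\}$ is a tree with node set $[n]$ together with a distinguished node, the root. A node $v$ of such a tree is a record if its label is the largest among the labels of the nodes on the unique path from $v$ to the root (both ends included). Let $R_\bullet(n,k)$ be the number of rooted trees labeled by $[n]$ with exactly $k$ records. Then $$R_\bullet(n,k) = k\,(n-1)(n-2)\cdots(n-k+1)\,n^{\,n-k-1},$$ as an identity of rational numbers, where $(n-1)(n-2)\cdots(n-k+1)$ denotes $\prod_{i=1}^{k-1}(n-i)$ (equal to $1$ for $k \le 1$) and the exponent $n-k-1$ may be negative. -/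

import Mathlib

/-- A rooted labeled tree with node set `V`: a tree on `V` together with a distinguished node. -/
@[ext]
structure RootedLabeledTree (V : Type*) where
  /-- the underlying graph -/
  graph : SimpleGraph V
  /-- the underlying graph is a tree (connected and acyclic) -/
  isTree : graph.IsTree
  /-- the root -/
  root : V

namespace RootedLabeledTree

/-- On finitely many nodes there are only finitely many rooted trees. -/
instance {V : Type*} [Finite V] : Finite (RootedLabeledTree V) :=
  Finite.of_injective (fun T : RootedLabeledTree V => (T.graph, T.root)) (by
    intro S T h
    rw [Prod.mk.injEq] at h
    exact RootedLabeledTree.ext h.1 h.2)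

/-- A node `v` is a record if it has the largest label along the (unique) path from `v` to the
root. -/
def IsRecord {V : Type*} [LinearOrder V] (T : RootedLabeledTree V) (v : V) : Prop :=
  ∀ p : T.graph.Walk v T.root, p.IsPath → ∀ u ∈ p.support, u ≤ v

/-- The number of records of a rooted labeled tree. -/
noncomputable def recordCount {V : Type*} [LinearOrder V] (T : RootedLabeledTree V) : ℕ :=
  {v : V | T.IsRecord v}.ncard

end RootedLabeledTree

/-- The tree record number: the number of rooted trees labeled with `{1, …, n}` that have exactly
`k` records. The label `j` is represented by the element `j - 1` of `Fin n`, which preserves the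
order of the labels. -/
noncomputable def treeRecordNumber (n k : ℕ) : ℕ :=
  Nat.card {T : RootedLabeledTree (Fin n) // T.recordCount = k}

/-!
A rooted tree is determined by its parent map `f`, which fixes the root and sends every other node
to its neighbour on the path to the root; a node is a record when it bounds all its iterates under
`f` (`treeRecordNumber_eq_parentMapCount`). This turns the problem into one on self-maps of a finite
linear order.

The largest node `⊤` is a record, and none of its proper descendants is. If `⊤` is not the root, cut
the edge from `⊤` to its parent. What remains is a tree on the set `S` of non-descendants of `⊤`,
with one record less, a node of `S` (the former parent of `⊤`), and a tree on the complement of `S`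
with root `⊤`; conversely such data can be glued (`glueParent`). If `⊤` is the root, it is the only
record. Writing `R(n, k)` for the number of trees with `k` records and `t(n)` for the number of
trees with a prescribed root, this gives `R(n, 1) = t(n)` and, for `k ≥ 1`
(`card_isParentMap_top_ne`, `parentMapCount_succ_succ`),

  `R(n + 1, k + 1) = ∑ m, n.choose m * R(m, k) * m * t(n + 1 - m)`.

The same decomposition without the condition on the number of records is a recurrence for `t` alone,
since there are `n * t(n)` rooted trees in all (`parentMapCountRoot_rec`). Both recurrences are
solved by Abel's generalization of the binomial theorem (`abel_identity`, `abel_identity_div`): the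
one for `t` yields Cayley's formula `t(n) = n ^ (n - 2)`, and the one for `R` then yields the claim
by induction on `k` (`parentMapCount_mul`). Abel's identity is proved by comparing derivatives,
together with one value, where it says that a high enough finite difference of a polynomial
vanishes.
-/

/-! ### Parent maps -/

/-- `f` is the parent map of a rooted tree on `V` with root `r`: the root is its own parent, and
every node has the root among its ancestors. -/
def IsParentMap {V : Type*} (f : V → V) (r : V) : Prop :=
  f r = r ∧ ∀ v, ∃ k, f^[k] v = r

/-- The records of a parent map: the nodes that bound all their ancestors `f^[k] v`. -/
def parentRecords {V : Type*} [LE V] (f : V → V) : Set V :=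
  {v | ∀ k, f^[k] v ≤ v}

/-- The number of parent maps on `V`, with arbitrary root, whose number of records satisfies `P`. -/
noncomputable def parentMapCount (V : Type*) [LE V] (P : ℕ → Prop) : ℕ :=
  Nat.card {f : V → V // (∃ r, IsParentMap f r) ∧ P (parentRecords f).ncard}

/-- The number of parent maps on `n + 1` nodes with a prescribed root. -/
noncomputable def parentMapCountRoot (n : ℕ) : ℕ :=
  Nat.card {f : Fin (n + 1) → Fin (n + 1) // IsParentMap f 0}

namespace IsParentMap

variable {V W : Type*} {f : V → V} {r v : V}

lemma iterate_root (hf : IsParentMap f r) (k : ℕ) : f^[k] r = r :=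
  Function.iterate_fixed hf.1 k

/-- The root is the only periodic point. -/
lemma eq_root_of_iterate_eq (hf : IsParentMap f r) {k : ℕ} (h : f^[k + 1] v = v) : v = r := by
  obtain ⟨m, hm⟩ := hf.2 v
  have h1 : f^[(k + 1) * m] v = v := by
    rw [Function.iterate_mul]; exact Function.iterate_fixed h m
  rw [show (k + 1) * m = k * m + m by ring, Function.iterate_add_apply, hm,
    hf.iterate_root] at h1
  exact h1.symm

lemma root_unique (hf : IsParentMap f r) {s : V} (hs : IsParentMap f s) : r = s :=
  hs.eq_root_of_iterate_eq (k := 0) hf.1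

lemma conj (e : V ≃ W) (hf : IsParentMap f r) : IsParentMap (e.conj f) (e r) := by
  have hsemi : Function.Semiconj e f (e.conj f) := fun v => by simp [Equiv.conj_apply]
  refine ⟨by simp [Equiv.conj_apply, hf.1], fun w => ?_⟩
  obtain ⟨k, hk⟩ := hf.2 (e.symm w)
  refine ⟨k, ?_⟩
  have := (hsemi.iterate_right k) (e.symm w)
  rw [hk, e.apply_symm_apply] at this
  exact this.symm

lemma conj_iff (e : V ≃ W) : IsParentMap (e.conj f) (e r) ↔ IsParentMap f r := by
  refine ⟨fun h => ?_, conj e⟩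
  have := h.conj e.symm
  rwa [← Equiv.conj_symm, Equiv.symm_apply_apply, Equiv.symm_apply_apply] at this

end IsParentMap

section Invariance

variable {V W : Type*}

lemma parentRecords_conj [LE V] [LE W] (e : V ≃o W) (f : V → V) :
    parentRecords (e.toEquiv.conj f) = e '' parentRecords f := by
  have hsemi : Function.Semiconj e f (e.toEquiv.conj f) := fun v => by simp [Equiv.conj_apply]
  ext w
  obtain ⟨v, rfl⟩ := e.surjective w
  rw [e.injective.mem_set_image]
  simp only [parentRecords, Set.mem_ofPred_eq]
  refine forall_congr' fun k => ?_
  rw [← (hsemi.iterate_right k) v, e.le_iff_le]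

lemma parentMapCount_congr [LE V] [LE W] (e : V ≃o W) (P : ℕ → Prop) :
    parentMapCount V P = parentMapCount W P := by
  refine Nat.card_congr (e.toEquiv.conj.subtypeEquiv fun f => ?_)
  rw [parentRecords_conj, Set.ncard_image_of_injective _ e.injective]
  refine and_congr_left' ⟨fun ⟨r, h⟩ => ⟨e r, h.conj e.toEquiv⟩, fun ⟨s, h⟩ => ?_⟩
  refine ⟨e.symm s, (IsParentMap.conj_iff e.toEquiv).1 ?_⟩
  simpa using h

lemma parentMapCount_eq_fin [LinearOrder V] [Fintype V] {n : ℕ} (hn : Fintype.card V = n)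
    (P : ℕ → Prop) : parentMapCount V P = parentMapCount (Fin n) P :=
  (parentMapCount_congr (monoEquivOfFin V hn) P).symm

lemma card_isParentMap_congr (e : V ≃ W) (r : V) :
    Nat.card {f : V → V // IsParentMap f r} = Nat.card {f : W → W // IsParentMap f (e r)} :=
  Nat.card_congr (e.conj.subtypeEquiv fun _ => (IsParentMap.conj_iff e).symm)

/-- The number of parent maps with root `r` does not depend on `r`: conjugate by a transposition. -/
lemma card_isParentMap [Fintype V] (r : V) {n : ℕ} (hn : Fintype.card V = n + 1) :
    Nat.card {f : V → V // IsParentMap f r} = parentMapCountRoot n := by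
  classical
  let e := Fintype.equivFinOfCardEq hn
  rw [card_isParentMap_congr (e.trans (Equiv.swap (e r) 0)) r]
  simp [parentMapCountRoot]

lemma parentMapCount_true [LE V] [Fintype V] {n : ℕ} (hn : Fintype.card V = n + 1) :
    parentMapCount V (fun _ => True) = (n + 1) * parentMapCountRoot n := by
  have e : (Σ r : V, {f : V → V // IsParentMap f r}) ≃
      {f : V → V // (∃ r, IsParentMap f r) ∧ True} := by
    refine Equiv.ofBijective (fun x => ⟨x.2.1, ⟨x.1, x.2.2⟩, trivial⟩) ⟨?_, ?_⟩
    · rintro ⟨r, f, hf⟩ ⟨s, g, hg⟩ h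
      obtain rfl : f = g := congrArg Subtype.val h
      obtain rfl := hf.root_unique hg
      rfl
    · rintro ⟨f, ⟨r, hf⟩, -⟩
      exact ⟨⟨r, f, hf⟩, rfl⟩
  rw [parentMapCount, ← Nat.card_congr e, Nat.card_sigma]
  simp [card_isParentMap _ hn, hn]

end Invariance

lemma IsParentMap.root_mem_parentRecords {V : Type*} [Preorder V] {f : V → V} {r : V}
    (hf : IsParentMap f r) :
    r ∈ parentRecords f := fun k => (hf.iterate_root k).le

section Records

variable {V : Type*} [LinearOrder V] [OrderTop V]

lemma top_mem_parentRecords (f : V → V) : ⊤ ∈ parentRecords f := fun _ => le_top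

/-- The only record is the top element exactly when the top element is the root. -/
lemma IsParentMap.ncard_parentRecords_eq_one_iff [Finite V] {f : V → V} {r : V}
    (hf : IsParentMap f r) : (parentRecords f).ncard = 1 ↔ r = ⊤ := by
  rw [Set.ncard_eq_one]
  constructor
  · rintro ⟨a, ha⟩
    have h1 := hf.root_mem_parentRecords
    have h2 := top_mem_parentRecords f
    rw [ha, Set.mem_singleton_iff] at h1 h2
    rw [h1, h2]
  · rintro rfl
    refine ⟨⊤, Set.eq_singleton_iff_unique_mem.2 ⟨top_mem_parentRecords f, fun v hv => ?_⟩⟩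
    obtain ⟨k, hk⟩ := hf.2 v
    exact top_le_iff.1 (hk ▸ hv k)

lemma parentMapCount_one [Fintype V] {n : ℕ} (hn : Fintype.card V = n + 1) :
    parentMapCount V (· = 1) = parentMapCountRoot n := by
  rw [← card_isParentMap (⊤ : V) hn]
  refine Nat.card_congr (Equiv.subtypeEquivRight fun f => ⟨?_, fun hf => ?_⟩)
  · rintro ⟨⟨r, hf⟩, h⟩
    rwa [hf.ncard_parentRecords_eq_one_iff.1 h] at hf
  · exact ⟨⟨_, hf⟩, hf.ncard_parentRecords_eq_one_iff.2 rfl⟩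

lemma parentMapCount_zero [Finite V] : parentMapCount V (· = 0) = 0 := by
  refine Nat.card_eq_zero.2 (Or.inl ⟨fun ⟨f, _, h⟩ => ?_⟩)
  have h' : (parentRecords f).ncard = 0 := h
  rw [Set.ncard_eq_zero] at h'
  exact Set.notMem_empty _ (h' ▸ top_mem_parentRecords f)

end Records

/-! ### Cutting off the descendants of a node -/

section Glue

open Classical in
/-- The parent map obtained from parent maps `g` on `S` and `h` on the complement of `S` by making
`p ∈ S` the parent of the node `a ∉ S`. -/
noncomputable def glueParent {V : Type*} {S : Set V} (a : V) (g : S → S) (p : S)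
    (h : ↥Sᶜ → ↥Sᶜ) (v : V) : V :=
  if hv : v ∈ S then g ⟨v, hv⟩ else if v = a then p else h ⟨v, hv⟩

variable {V : Type*} {S : Set V} {a : V} {g : S → S} {p : S} {h : ↥Sᶜ → ↥Sᶜ}

lemma glueParent_of_mem (v : S) : glueParent a g p h v = g v := by
  simp [glueParent]

lemma glueParent_self (ha : a ∉ S) : glueParent a g p h a = p := by
  simp [glueParent, ha]

lemma glueParent_of_ne (v : ↥Sᶜ) (hv : (v : V) ≠ a) : glueParent a g p h v = h v := by
  have : (v : V) ∉ S := v.2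
  simp [glueParent, hv, this]

lemma iterate_glueParent (v : S) (k : ℕ) : (glueParent a g p h)^[k] v = g^[k] v := by
  have hsemi : Function.Semiconj (Subtype.val : S → V) g (glueParent a g p h) :=
    fun v => (glueParent_of_mem v).symm
  exact ((hsemi.iterate_right k) v).symm

lemma exists_iterate_glueParent_eq {ha : a ∈ Sᶜ} (hh : IsParentMap h ⟨a, ha⟩) (v : ↥Sᶜ) :
    ∃ k, (glueParent a g p h)^[k] v = a := by
  obtain ⟨k, hk⟩ := hh.2 v
  induction k generalizing v with
  | zero => exact ⟨0, congrArg Subtype.val hk⟩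
  | succ k ih =>
    by_cases hv : (v : V) = a
    · exact ⟨0, hv⟩
    · obtain ⟨j, hj⟩ := ih (h v) hk
      exact ⟨j + 1, by rw [Function.iterate_succ_apply, glueParent_of_ne v hv, hj]⟩

lemma isParentMap_glueParent {r : S} (hg : IsParentMap g r) {ha : a ∈ Sᶜ}
    (hh : IsParentMap h ⟨a, ha⟩) : IsParentMap (glueParent a g p h) r := by
  refine ⟨by rw [glueParent_of_mem, hg.1], fun v => ?_⟩
  have hS (v : S) : ∃ k, (glueParent a g p h)^[k] v = r := by
    obtain ⟨k, hk⟩ := hg.2 v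
    exact ⟨k, by rw [iterate_glueParent, hk]⟩
  by_cases hv : v ∈ S
  · exact hS ⟨v, hv⟩
  · obtain ⟨k, hk⟩ := exists_iterate_glueParent_eq (g := g) (p := p) hh ⟨v, hv⟩
    obtain ⟨j, hj⟩ := hS p
    refine ⟨j + (1 + k), ?_⟩
    rw [Function.iterate_add_apply, Function.iterate_add_apply]
    simp only at hk
    rw [hk, Function.iterate_one, glueParent_self ha, hj]

lemma setOf_iterate_glueParent_ne {ha : a ∈ Sᶜ} (hh : IsParentMap h ⟨a, ha⟩) :
    {v | ∀ k, (glueParent a g p h)^[k] v ≠ a} = S := by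
  ext v
  refine ⟨fun hv => ?_, fun hv k hk => ?_⟩
  · by_contra hvS
    obtain ⟨k, hk⟩ := exists_iterate_glueParent_eq (g := g) (p := p) hh ⟨v, hvS⟩
    exact hv k hk
  · have := iterate_glueParent (a := a) (g := g) (p := p) (h := h) ⟨v, hv⟩ k
    rw [hk] at this
    exact ha (this ▸ (g^[k] ⟨v, hv⟩).2)

lemma parentRecords_glueParent [LinearOrder V] [OrderTop V] {ht : ⊤ ∈ Sᶜ}
    (hh : IsParentMap h ⟨⊤, ht⟩) :
    parentRecords (glueParent ⊤ g p h) = insert ⊤ (Subtype.val '' parentRecords g) := by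
  ext v
  rw [Set.mem_insert_iff]
  by_cases hv : v ∈ S
  · have hne : v ≠ ⊤ := fun e => ht (e ▸ hv)
    lift v to S using hv
    rw [Subtype.val_injective.mem_set_image]
    simp [parentRecords, iterate_glueParent, hne, ← Subtype.coe_le_coe]
  · have h1 : v ∉ Subtype.val '' parentRecords g := by
      rintro ⟨w, -, rfl⟩
      exact hv w.2
    simp only [h1, or_false]
    refine ⟨fun hr => ?_, by rintro rfl; exact top_mem_parentRecords _⟩
    obtain ⟨k, hk⟩ := exists_iterate_glueParent_eq (g := g) (p := p) hh ⟨v, hv⟩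
    exact top_le_iff.1 (hk ▸ hr k)

lemma ncard_parentRecords_glueParent [LinearOrder V] [OrderTop V] [Finite V] {ht : ⊤ ∈ Sᶜ}
    (hh : IsParentMap h ⟨⊤, ht⟩) :
    (parentRecords (glueParent ⊤ g p h)).ncard = (parentRecords g).ncard + 1 := by
  rw [parentRecords_glueParent hh, Set.ncard_insert_of_notMem,
    Set.ncard_image_of_injective _ Subtype.val_injective]
  rintro ⟨w, -, hw⟩
  exact ht (hw ▸ w.2)

/-- Every parent map whose root is not `a` arises by gluing, where `S` is the set of nodes that do
not descend from `a`. -/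
lemma IsParentMap.exists_eq_glueParent {f : V → V} {r a : V} (hf : IsParentMap f r) (ha : f a ≠ a)
    {S : Set V} (hS : {v | ∀ k, f^[k] v ≠ a} = S) :
    ∃ (g : S → S) (p : S) (h : ↥Sᶜ → ↥Sᶜ) (haS : a ∈ Sᶜ),
      (∃ s, IsParentMap g s) ∧ IsParentMap h ⟨a, haS⟩ ∧ glueParent a g p h = f := by
  classical
  subst hS
  set S := {v | ∀ k, f^[k] v ≠ a} with hS
  have haS : a ∈ Sᶜ := fun h => h 0 rfl
  have hmaps (v : V) (hv : v ∈ S) : f v ∈ S := fun k => hv (k + 1)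
  have hpS : f a ∈ S := fun k hk => by
    have e := hf.eq_root_of_iterate_eq (v := a) (k := k) hk
    exact ha (by rw [e, hf.1])
  have hrS : r ∈ S := fun k hk => by
    rw [hf.iterate_root] at hk
    exact ha (by rw [← hk, hf.1])
  have hmaps' (v : V) (hv : v ∈ Sᶜ) (hva : v ≠ a) : f v ∈ Sᶜ := fun hfv => hv fun k => by
    cases k with
    | zero => exact hva
    | succ k => exact hfv k
  let g : S → S := fun v => ⟨f v, hmaps v v.2⟩
  let h : ↥Sᶜ → ↥Sᶜ := fun v => if hva : (v : V) = a then ⟨a, haS⟩ else ⟨f v, hmaps' v v.2 hva⟩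
  have hh : IsParentMap h ⟨a, haS⟩ := by
    refine ⟨by simp [h], fun v => ?_⟩
    obtain ⟨k, hk⟩ : ∃ k, f^[k] v = a := by
      have hv : ¬ ∀ k, f^[k] v ≠ a := v.2
      simpa using hv
    induction k generalizing v with
    | zero => exact ⟨0, Subtype.ext hk⟩
    | succ k ih =>
      by_cases hva : (v : V) = a
      · exact ⟨0, Subtype.ext hva⟩
      · have hv : h v = ⟨f v, hmaps' v v.2 hva⟩ := by simp [h, hva]
        obtain ⟨j, hj⟩ := ih (h v) (by rw [hv]; exact hk)
        exact ⟨j + 1, hj⟩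
  have hg : IsParentMap g ⟨r, hrS⟩ := by
    refine ⟨Subtype.ext hf.1, fun v => ?_⟩
    obtain ⟨k, hk⟩ := hf.2 v
    have hsemi : Function.Semiconj (Subtype.val : S → V) g f := fun _ => rfl
    exact ⟨k, Subtype.ext (((hsemi.iterate_right k) v).trans hk)⟩
  refine ⟨g, ⟨f a, hpS⟩, h, haS, ⟨_, hg⟩, hh, funext fun v => ?_⟩
  by_cases hv : v ∈ S
  · exact glueParent_of_mem ⟨v, hv⟩
  · by_cases hva : v = a
    · rw [hva, glueParent_self haS]
    · rw [glueParent_of_ne ⟨v, hv⟩ hva]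
      simp [h, hva]

lemma card_setOf_iterate_ne_top_eq [LinearOrder V] [OrderTop V] [Finite V] (P : ℕ → Prop)
    (ht : ⊤ ∈ Sᶜ) :
    Nat.card {f : V → V // ((∃ r, IsParentMap f r) ∧ f ⊤ ≠ ⊤ ∧ P (parentRecords f).ncard) ∧
      {v | ∀ k, f^[k] v ≠ ⊤} = S} =
    parentMapCount S (fun k => P (k + 1)) * Nat.card S *
      Nat.card {h : ↥Sᶜ → ↥Sᶜ // IsParentMap h ⟨⊤, ht⟩} := by
  rw [parentMapCount, ← Nat.card_prod, ← Nat.card_prod]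
  symm
  refine Nat.card_congr (Equiv.ofBijective
    (fun x => ⟨glueParent ⊤ x.1.1.1 x.1.2 x.2.1, ⟨?_, ?_, ?_⟩, ?_⟩) ⟨?_, ?_⟩)
  · obtain ⟨r, hr⟩ := x.1.1.2.1
    exact ⟨r, isParentMap_glueParent hr x.2.2⟩
  · rw [glueParent_self ht]
    exact fun e => ht (e ▸ x.1.2.2)
  · rw [ncard_parentRecords_glueParent x.2.2]
    exact x.1.1.2.2
  · exact setOf_iterate_glueParent_ne x.2.2
  · rintro ⟨⟨⟨g, hg⟩, p⟩, ⟨h, hh⟩⟩ ⟨⟨⟨g', hg'⟩, p'⟩, ⟨h', hh'⟩⟩ e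
    have e' : glueParent ⊤ g p h = glueParent ⊤ g' p' h' := congrArg Subtype.val e
    obtain rfl : g = g' := funext fun v => Subtype.ext <| by
      rw [← glueParent_of_mem (a := ⊤) (p := p) (h := h) v, e', glueParent_of_mem]
    obtain rfl : p = p' := Subtype.ext <| by
      rw [← glueParent_self (g := g) (p := p) (h := h) ht, e', glueParent_self ht]
    obtain rfl : h = h' := funext fun v => by
      by_cases hv : (v : V) = ⊤
      · obtain rfl : v = ⟨⊤, ht⟩ := Subtype.ext hv
        rw [hh.1, hh'.1]
      · refine Subtype.ext ?_
        rw [← glueParent_of_ne (g := g) (p := p) v hv, e', glueParent_of_ne v hv]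
    rfl
  · rintro ⟨f, ⟨⟨r, hf⟩, ha, hP⟩, hfS⟩
    obtain ⟨g, p, h, _, hg, hh, rfl⟩ := hf.exists_eq_glueParent ha hfS
    rw [ncard_parentRecords_glueParent hh] at hP
    exact ⟨⟨⟨⟨g, hg, hP⟩, p⟩, ⟨h, hh⟩⟩, rfl⟩

/-- Parent maps on `n + 1` nodes whose root is not the top node, sorted by the number `m` of nodes
that do not descend from the top node. -/
lemma card_isParentMap_top_ne (n : ℕ) (P : ℕ → Prop) :
    Nat.card {f : Fin (n + 1) → Fin (n + 1) //
      (∃ r, IsParentMap f r) ∧ f ⊤ ≠ ⊤ ∧ P (parentRecords f).ncard} =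
    ∑ m ∈ Finset.range (n + 1), n.choose m *
      (parentMapCount (Fin m) (fun k => P (k + 1)) * m * parentMapCountRoot (n - m)) := by
  classical
  let ψ (f : {f : Fin (n + 1) → Fin (n + 1) //
      (∃ r, IsParentMap f r) ∧ f ⊤ ≠ ⊤ ∧ P (parentRecords f).ncard}) : Finset (Fin (n + 1)) :=
    Finset.univ.filter fun v => ∀ k, f.1^[k] v ≠ ⊤
  have hψ (f) : (ψ f : Set (Fin (n + 1))) = {v | ∀ k, f.1^[k] v ≠ ⊤} := by simp [ψ]
  rw [← Nat.card_congr (Equiv.sigmaFiberEquiv ψ), Nat.card_sigma]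
  have hcard : (Finset.univ.erase (⊤ : Fin (n + 1))).card = n := by simp
  conv_rhs => rw [← hcard]
  simp_rw [← smul_eq_mul (a := Nat.choose _ _)]
  rw [← Finset.sum_powerset_apply_card (fun m => parentMapCount (Fin m) (fun k => P (k + 1)) * m *
    parentMapCountRoot ((Finset.univ.erase (⊤ : Fin (n + 1))).card - m))]
  rw [hcard]
  symm
  refine Finset.sum_subset_zero_on_sdiff (Finset.subset_univ _) (fun S hS => ?_) (fun S hS => ?_)
  · have ht : ⊤ ∈ S := by
      by_contra ht
      simp only [Finset.mem_sdiff, Finset.mem_univ, true_and, Finset.mem_powerset] at hS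
      exact hS fun v hv => Finset.mem_erase.2 ⟨fun e => ht (e ▸ hv), Finset.mem_univ _⟩
    refine Nat.card_eq_zero.2 (Or.inl ⟨fun ⟨f, hf⟩ => ?_⟩)
    rw [← hf] at ht
    exact (Finset.mem_filter.1 ht).2 0 rfl
  · have ht : ⊤ ∈ (S : Set (Fin (n + 1)))ᶜ := fun h =>
      (Finset.mem_erase.1 (Finset.mem_powerset.1 hS h)).1 rfl
    have e1 := card_setOf_iterate_ne_top_eq (S := (S : Set (Fin (n + 1)))) P ht
    have hc : Fintype.card ↥(S : Set (Fin (n + 1)))ᶜ = n - S.card + 1 := by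
      have hle := Finset.card_le_card (Finset.mem_powerset.1 hS)
      rw [hcard] at hle
      rw [Fintype.card_compl_set]
      simp
      lia
    rw [card_isParentMap _ hc, parentMapCount_eq_fin (V := ↥(S : Set (Fin (n + 1))))
      (Fintype.card_coe S)] at e1
    simp only [Nat.card_eq_fintype_card, Fintype.card_coe, Finset.coe_sort_coe] at e1
    rw [← e1, ← Nat.card_eq_fintype_card]
    refine Nat.card_congr ((Equiv.subtypeSubtypeEquivSubtypeInter _ _).symm.trans
      (Equiv.subtypeEquivRight fun f => ?_))
    rw [← Finset.coe_inj, hψ]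

end Glue

/-! ### Rooted trees and parent maps -/

section Trees

variable {V : Type*}

/-- The graph joining every node to its parent. -/
def parentGraph (f : V → V) : SimpleGraph V :=
  SimpleGraph.fromRel fun u v => f u = v

lemma parentGraph_adj {f : V → V} {u v : V} :
    (parentGraph f).Adj u v ↔ u ≠ v ∧ (f u = v ∨ f v = u) :=
  SimpleGraph.fromRel_adj _ _ _

namespace IsParentMap

variable {f : V → V} {r : V}

lemma apply_ne (hf : IsParentMap f r) {v : V} (hv : v ≠ r) : f v ≠ v :=
  fun h => hv (hf.eq_root_of_iterate_eq (k := 0) h)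

lemma parentGraph_adj_apply (hf : IsParentMap f r) {v : V} (hv : v ≠ r) :
    (parentGraph f).Adj v (f v) :=
  parentGraph_adj.2 ⟨(hf.apply_ne hv).symm, Or.inl rfl⟩

/-- In a graph that joins every node to its parent, the iterated parents of `v` form a path from `v`
to the root. -/
lemma exists_isPath (hf : IsParentMap f r) {G : SimpleGraph V}
    (hG : ∀ v, v ≠ r → G.Adj v (f v)) (v : V) :
    ∃ p : G.Walk v r, p.IsPath ∧ (∀ u, u ∈ p.support ↔ ∃ k, f^[k] v = u) ∧
      (v ≠ r → p.snd = f v) := by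
  obtain ⟨k, hk⟩ := hf.2 v
  induction k generalizing v with
  | zero =>
    obtain rfl : v = r := hk
    exact ⟨.nil, by simp, fun u => by simp [hf.iterate_root, eq_comm], fun h => absurd rfl h⟩
  | succ k ih =>
    by_cases hv : v = r
    · subst hv
      exact ⟨.nil, by simp, fun u => by simp [hf.iterate_root, eq_comm], fun h => absurd rfl h⟩
    · obtain ⟨p, hp, hsupp, -⟩ := ih (f v) hk
      refine ⟨.cons (hG v hv) p, hp.cons fun hmem => ?_, fun u => ?_, fun _ => by simp⟩
      · obtain ⟨j, hj⟩ := (hsupp v).1 hmem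
        exact hv (hf.eq_root_of_iterate_eq (k := j) hj)
      · rw [SimpleGraph.Walk.support_cons, List.mem_cons, hsupp]
        constructor
        · rintro (rfl | ⟨j, hj⟩)
          · exact ⟨0, rfl⟩
          · exact ⟨j + 1, hj⟩
        · rintro ⟨_ | j, hj⟩
          · exact Or.inl hj.symm
          · exact Or.inr ⟨j, hj⟩

lemma connected_parentGraph (hf : IsParentMap f r) : (parentGraph f).Connected := by
  have h (v : V) : (parentGraph f).Reachable v r :=
    let ⟨p, _⟩ := hf.exists_isPath (fun _ => hf.parentGraph_adj_apply) v
    p.reachable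
  exact { preconnected := fun u v => (h u).trans (h v).symm, nonempty := ⟨r⟩ }

/-- The parent graph is connected, and has at most one edge for every node other than the root. -/
lemma isTree_parentGraph [Finite V] (hf : IsParentMap f r) : (parentGraph f).IsTree := by
  have hc := hf.connected_parentGraph
  refine SimpleGraph.isTree_iff_connected_and_card.2 ⟨hc, ?_⟩
  refine le_antisymm ?_ hc.card_vert_le_card_edgeSet_add_one
  have hsub : (parentGraph f).edgeSet ⊆ (fun v => s(v, f v)) '' {v | v ≠ r} := by
    intro e
    induction e with
    | _ u v =>
      rw [SimpleGraph.mem_edgeSet, parentGraph_adj]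
      rintro ⟨hne, rfl | rfl⟩
      · exact ⟨u, fun h => hne (by rw [h, hf.1]), rfl⟩
      · exact ⟨v, fun h => hne (by rw [h, hf.1]), Sym2.eq_swap⟩
  have h1 := (Set.ncard_le_ncard hsub (Set.toFinite _)).trans (Set.ncard_image_le (Set.toFinite _))
  have h2 : ({v | v ≠ r} : Set V).ncard + 1 = Nat.card V := by
    have := Set.ncard_add_ncard_compl ({r} : Set V)
    rw [Set.ncard_singleton, add_comm] at this
    exact this
  rw [Nat.card_coe_set_eq]
  lia

end IsParentMap

/-- A tree that joins every node other than the root to its parent is the parent graph. -/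
lemma IsParentMap.parentGraph_eq {f : V → V} {r : V} (hf : IsParentMap f r)
    {G : SimpleGraph V} (hG : G.IsTree) (h : ∀ v, v ≠ r → G.Adj v (f v)) : parentGraph f = G := by
  have hle : parentGraph f ≤ G := by
    intro u v huv
    obtain ⟨hne, rfl | rfl⟩ := parentGraph_adj.1 huv
    · exact h u fun e => hne (by rw [e, hf.1])
    · exact (h v fun e => hne (by rw [e, hf.1])).symm
  exact le_antisymm hle
    ((SimpleGraph.isTree_iff_minimal_connected.1 hG).le_of_le hf.connected_parentGraph hle)

/-- Every rooted tree has a parent map: the next node on the path to the root. -/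
lemma RootedLabeledTree.exists_isParentMap (T : RootedLabeledTree V) :
    ∃ f : V → V, IsParentMap f T.root ∧ parentGraph f = T.graph := by
  classical
  choose p hp _ using fun v => T.isTree.existsUnique_path v T.root
  let f : V → V := fun v => (p v).snd
  have hroot : f T.root = T.root := by
    have : p T.root = .nil := (SimpleGraph.Walk.isPath_iff_nil.1 (hp T.root)).eq_nil
    simp [f, this]
  have hadj (v : V) (hv : v ≠ T.root) : T.graph.Adj v (f v) :=
    (p v).adj_snd (SimpleGraph.Walk.not_nil_of_ne hv)
  have hreach (n : ℕ) : ∀ v (q : T.graph.Walk v T.root), q.IsPath → q.length = n →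
      f^[n] v = T.root := by
    induction n with
    | zero => exact fun v q _ hq => SimpleGraph.Walk.eq_of_length_eq_zero hq
    | succ n ih =>
      intro v q hq hlen
      obtain rfl : p v = q := congrArg Subtype.val
        ((T.isTree.isAcyclic.subsingleton_path _ _).elim ⟨p v, hp v⟩ ⟨q, hq⟩)
      have hnil : ¬ (p v).Nil := fun h => by
        rw [SimpleGraph.Walk.length_eq_zero_iff.2 h] at hlen
        lia
      refine ih (f v) (p v).tail hq.tail ?_
      have := (p v).length_tail_add_one hnil
      lia
  have hf : IsParentMap f T.root := ⟨hroot, fun v => ⟨_, hreach _ v (p v) (hp v) rfl⟩⟩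
  exact ⟨f, hf, hf.parentGraph_eq T.isTree hadj⟩

/-- A parent map is determined by its root and its graph. -/
lemma IsParentMap.eq_of_parentGraph_eq [Finite V] {f g : V → V} {r : V} (hf : IsParentMap f r)
    (hg : IsParentMap g r) (h : parentGraph f = parentGraph g) : f = g := by
  funext v
  by_cases hv : v = r
  · rw [hv, hf.1, hg.1]
  · obtain ⟨p, hp, -, hpv⟩ := hf.exists_isPath (fun _ => hf.parentGraph_adj_apply) v
    obtain ⟨q, hq, -, hqv⟩ := hg.exists_isPath (G := parentGraph f)
      (fun _ hw => h ▸ hg.parentGraph_adj_apply hw) v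
    obtain rfl : p = q := congrArg Subtype.val
        ((hf.isTree_parentGraph.isAcyclic.subsingleton_path _ _).elim ⟨p, hp⟩ ⟨q, hq⟩)
    rw [← hpv hv, hqv hv]

lemma IsParentMap.isRecord_iff [LinearOrder V] {f : V → V} {T : RootedLabeledTree V}
    (hf : IsParentMap f T.root) (hT : parentGraph f = T.graph) (v : V) :
    T.IsRecord v ↔ v ∈ parentRecords f := by
  obtain ⟨p, hp, hsupp, -⟩ := hf.exists_isPath (G := T.graph)
    (fun _ hw => hT ▸ hf.parentGraph_adj_apply hw) v
  constructor
  · exact fun h k => h p hp _ ((hsupp _).2 ⟨k, rfl⟩)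
  · intro h q hq u hu
    obtain rfl : p = q := congrArg Subtype.val
        ((T.isTree.isAcyclic.subsingleton_path _ _).elim ⟨p, hp⟩ ⟨q, hq⟩)
    obtain ⟨k, rfl⟩ := (hsupp u).1 hu
    exact h k

lemma treeRecordNumber_eq_parentMapCount (n k : ℕ) :
    treeRecordNumber n k = parentMapCount (Fin n) (· = k) := by
  choose f hf hfT using fun T : RootedLabeledTree (Fin n) => T.exists_isParentMap
  have hrec (T : RootedLabeledTree (Fin n)) : T.recordCount = (parentRecords (f T)).ncard :=
    congrArg Set.ncard (Set.ext fun v => (hf T).isRecord_iff (hfT T) v)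
  refine Nat.card_congr (Equiv.ofBijective
    (fun T => ⟨f T.1, ⟨_, hf T.1⟩, (hrec T.1).symm.trans T.2⟩) ⟨?_, ?_⟩)
  · rintro ⟨S, hS⟩ ⟨T, hT⟩ h
    have h' : f S = f T := congrArg Subtype.val h
    refine Subtype.ext (RootedLabeledTree.ext ?_ ?_)
    · rw [← hfT S, h', hfT T]
    · exact (hf S).root_unique (h' ▸ hf T)
  · rintro ⟨g, ⟨r, hg⟩, hk⟩
    let T : RootedLabeledTree (Fin n) := ⟨parentGraph g, hg.isTree_parentGraph, r⟩
    have hT : f T = g := (hf T).eq_of_parentGraph_eq hg (hfT T)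
    exact ⟨⟨T, by rw [hrec, hT]; exact hk⟩, Subtype.ext hT⟩

end Trees

/-! ### Abel's identity -/

section Abel

open Finset Polynomial

/-- The sum over `j` of `(-1) ^ j * N.choose j * (N + 1 - j) ^ (N - 1)` is an `N`-th difference of a
polynomial of degree `N - 1`. -/
lemma sum_neg_one_pow_mul_choose_mul_pow (N : ℕ) :
    ∑ j ∈ range (N + 2), (-1 : ℚ) ^ j * (N + 1).choose j * ((N + 2 : ℚ) - j) ^ N = 0 := by
  have h := congrFun (fwdDiff_iter_pow_eq_zero_of_lt (R := ℚ) (Nat.lt_succ_self N)) 1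
  rw [fwdDiff_iter_eq_sum_shift, ← sum_range_reflect, Pi.zero_apply] at h
  rw [← h]
  refine sum_congr rfl fun j hj => ?_
  have hj' : j ≤ N + 1 := by simpa [Nat.lt_succ_iff] using hj
  have e1 : N.succ + 1 - 1 - j = N + 1 - j := by lia
  have e2 : N.succ - (N + 1 - j) = j := by lia
  rw [e1, e2, Nat.succ_eq_add_one, Nat.choose_symm hj', zsmul_eq_mul, nsmul_eq_mul,
    Nat.cast_sub hj']
  push_cast
  ring

/-- The case `y = 1` of Abel's identity
`∑ j, N.choose j * (x + j) ^ j * y * (y + N - j) ^ (N - j - 1) = (x + y + N) ^ N`, as an identity of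
polynomials in `x`. At `j = N` the truncated exponent does no harm, since its base is `1`. -/
lemma abel_identity_poly (N : ℕ) :
    ∑ j ∈ range (N + 1), (C (N.choose j * ((N - j : ℕ) + 1 : ℚ) ^ (N - j - 1))) *
      (X + C (j : ℚ)) ^ j = (X + C (N + 1 : ℚ)) ^ N := by
  induction N with
  | zero => simp
  | succ N ih =>
    -- Both sides have the same derivative by induction, and both vanish at `-(N + 2)`.
    rw [← sub_eq_zero]
    set D := (∑ j ∈ range (N + 1 + 1),
      (C ((N + 1).choose j * ((N + 1 - j : ℕ) + 1 : ℚ) ^ (N + 1 - j - 1))) *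
        (X + C (j : ℚ)) ^ j) - (X + C ((N + 1 : ℕ) + 1 : ℚ)) ^ (N + 1) with hD
    have hder : derivative D = 0 := by
      have ih' := congrArg (fun p : ℚ[X] => C (N + 1 : ℚ) * p.comp (X + C 1)) ih
      simp only [Polynomial.sum_comp, mul_comp, pow_comp, add_comp, X_comp, C_comp] at ih'
      rw [hD, derivative_sub, derivative_sum, sum_range_succ', sub_eq_zero]
      simp only [derivative_mul, derivative_C, derivative_X_add_C_pow, zero_mul, zero_add]
      simp only [CharP.cast_eq_zero, zero_mul, mul_zero, add_zero, C_0]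
      rw [mul_sum] at ih'
      convert ih' using 1
      · refine sum_congr rfl fun j hj => ?_
        have hc : ((N + 1).choose (j + 1) : ℚ) * (j + 1 : ℕ) = (N + 1) * N.choose j := by
          exact_mod_cast (Nat.add_one_mul_choose_eq N j).symm
        rw [Nat.add_sub_add_right, Nat.add_sub_cancel]
        have e : (X + C ((j + 1 : ℕ) : ℚ) : ℚ[X]) = X + C 1 + C (j : ℚ) := by
          simp only [Nat.cast_add, Nat.cast_one, C_add]; ring
        rw [e, ← mul_assoc, ← mul_assoc, ← C_mul, ← C_mul, mul_right_comm, hc]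
        congr 2
        ring
      · rw [Nat.add_sub_cancel]
        push_cast
        simp only [C_add, C_1, map_natCast]
        ring
    have heval : D.eval (-(N + 2 : ℚ)) = 0 := by
      rw [hD, eval_sub, eval_finsetSum]
      have h0 : eval (-(N + 2 : ℚ)) ((X + C ((N + 1 : ℕ) + 1 : ℚ)) ^ (N + 1)) = 0 := by
        simp only [eval_pow, eval_add, eval_X, eval_C]
        push_cast
        rw [show -(N + 2 : ℚ) + (N + 1 + 1) = 0 by ring]
        exact zero_pow (Nat.succ_ne_zero N)
      rw [h0, sub_zero, ← sum_neg_one_pow_mul_choose_mul_pow N]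
      refine sum_congr rfl fun j hj => ?_
      have hj' : j ≤ N + 1 := by simpa [Nat.lt_succ_iff] using hj
      simp only [eval_mul, eval_pow, eval_add, eval_X, eval_C]
      have e1 : -(N + 2 : ℚ) + j = -1 * (N + 2 - j) := by ring
      have e2 : (((N + 1 - j : ℕ) : ℚ) + 1) = N + 2 - j := by
        rw [Nat.cast_sub hj']; push_cast; ring
      rw [e1, e2, mul_pow]
      rcases hj'.eq_or_lt with rfl | hlt
      · have : (N + 2 - (N + 1 : ℕ) : ℚ) = 1 := by push_cast; ring
        rw [this]
        simp
      · have e3 : N = (N + 1 - j - 1) + j := by lia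
        conv_rhs => rw [e3, pow_add]
        rw [← e3]
        ring
    have hconst := derivative_eq_zero.1 hder
    rw [eq_C_of_natDegree_eq_zero hconst, eval_C] at heval
    rw [eq_C_of_natDegree_eq_zero hconst, heval, C_0]

lemma abel_identity (N : ℕ) (x : ℚ) :
    ∑ j ∈ range (N + 1), (N.choose j : ℚ) * (x + j) ^ j *
      ((N - j : ℕ) + 1 : ℚ) ^ (N - j - 1) = (x + (N + 1)) ^ N := by
  have h := congrArg (eval x) (abel_identity_poly N)
  simp only [eval_finsetSum, eval_mul, eval_pow, eval_add, eval_X, eval_C] at h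
  rw [← h]
  exact sum_congr rfl fun j _ => by ring

/-- The variant of `abel_identity` with exponents lowered by one. It is stated for `x > 0`, so that
the summand at `j = 0` is the intended one. -/
lemma abel_identity_div (N : ℕ) {x : ℚ} (hx : 0 < x) :
    ∑ j ∈ range (N + 1), (N.choose j : ℚ) * (x * (x + j) ^ j / (x + j)) *
      ((N - j : ℕ) + 1 : ℚ) ^ (N - j - 1) = (x + 1) * (x + (N + 1)) ^ N / (x + (N + 1)) := by
  have hsplit (j : ℕ) : x * (x + j) ^ j / (x + j) = (x + j) ^ j - j * (x + j) ^ (j - 1) := by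
    cases j with
    | zero => simp [hx.ne']
    | succ j =>
      have : x + ((j + 1 : ℕ) : ℚ) ≠ 0 := by positivity
      rw [Nat.add_sub_cancel]
      field_simp
      ring
  have h2 : ∑ j ∈ range (N + 1), (N.choose j : ℚ) * (j * (x + j) ^ (j - 1)) *
      ((N - j : ℕ) + 1 : ℚ) ^ (N - j - 1) = N * (x + (N + 1)) ^ N / (x + (N + 1)) := by
    cases N with
    | zero => simp
    | succ N =>
      rw [sum_range_succ']
      have h := abel_identity N (x + 1)
      have hne : x + (((N + 1 : ℕ) : ℚ) + 1) ≠ 0 := by positivity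
      have e0 : x + 1 + (N + 1 : ℚ) = x + (((N + 1 : ℕ) : ℚ) + 1) := by push_cast; ring
      rw [e0] at h
      rw [pow_succ, ← mul_assoc ((N + 1 : ℕ) : ℚ), mul_div_cancel_right₀ _ hne, ← h, mul_sum]
      simp only [CharP.cast_eq_zero, zero_mul, mul_zero, add_zero]
      refine sum_congr rfl fun j _ => ?_
      have hc : ((N + 1).choose (j + 1) : ℚ) * (j + 1 : ℕ) = (N + 1 : ℕ) * N.choose j := by
        exact_mod_cast (Nat.add_one_mul_choose_eq N j).symm
      rw [Nat.add_sub_cancel, Nat.add_sub_add_right, ← mul_assoc, hc]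
      push_cast
      ring
  simp_rw [hsplit, mul_sub, sub_mul]
  rw [sum_sub_distrib, h2, abel_identity]
  have hne : x + ((N : ℚ) + 1) ≠ 0 := by positivity
  field_simp
  ring

end Abel

/-! ### Solving the recurrence -/

section Count

open Finset

lemma card_isParentMap_split (n : ℕ) (P : ℕ → Prop) :
    parentMapCount (Fin (n + 1)) P =
      Nat.card {f : Fin (n + 1) → Fin (n + 1) //
        (∃ r, IsParentMap f r) ∧ f ⊤ = ⊤ ∧ P (parentRecords f).ncard} +
      Nat.card {f : Fin (n + 1) → Fin (n + 1) //
        (∃ r, IsParentMap f r) ∧ f ⊤ ≠ ⊤ ∧ P (parentRecords f).ncard} := by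
  classical
  rw [parentMapCount, Nat.card_eq_fintype_card, Nat.card_eq_fintype_card,
    Nat.card_eq_fintype_card, ← Fintype.card_subtype_or_disjoint]
  · exact Fintype.card_congr (Equiv.subtypeEquivRight fun f => by tauto)
  · rw [Pi.disjoint_iff]
    intro f
    rw [Prop.disjoint_iff]
    tauto

lemma IsParentMap.apply_eq_self_iff {V : Type*} {f : V → V} {r v : V} (hf : IsParentMap f r) :
    f v = v ↔ r = v :=
  ⟨fun h => (hf.eq_root_of_iterate_eq (k := 0) h).symm, fun h => h ▸ hf.1⟩

/-- The count of all parent maps, sorted by the descendants of the top node. Together with the fact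
that the number of parent maps with a given root does not depend on the root, it involves no counts
but those with a given root. -/
lemma parentMapCountRoot_rec (n : ℕ) :
    n * parentMapCountRoot n = ∑ m ∈ range n, n.choose (m + 1) *
      ((m + 1) ^ 2 * parentMapCountRoot m * parentMapCountRoot (n - (m + 1))) := by
  have h := card_isParentMap_split n (fun _ => True)
  rw [parentMapCount_true (Fintype.card_fin _), card_isParentMap_top_ne n (fun _ => True),
    sum_range_succ'] at h
  have h1 : Nat.card {f : Fin (n + 1) → Fin (n + 1) //
      (∃ r, IsParentMap f r) ∧ f ⊤ = ⊤ ∧ True} = parentMapCountRoot n := by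
    rw [← card_isParentMap (⊤ : Fin (n + 1)) (Fintype.card_fin _)]
    refine Nat.card_congr (Equiv.subtypeEquivRight fun f =>
      ⟨?_, fun hf => ⟨⟨_, hf⟩, hf.1, trivial⟩⟩)
    rintro ⟨⟨r, hf⟩, ht, -⟩
    exact hf.apply_eq_self_iff.1 ht ▸ hf
  rw [h1, add_one_mul, add_comm, Nat.add_left_cancel_iff] at h
  rw [h]
  simp only [mul_zero, zero_mul, add_zero]
  refine sum_congr rfl fun m _ => ?_
  rw [parentMapCount_true (Fintype.card_fin _)]
  ring

/-- Cayley's formula, for trees on `n + 1` nodes with a prescribed root. -/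
lemma parentMapCountRoot_eq (n : ℕ) : parentMapCountRoot n = (n + 1) ^ (n - 1) := by
  induction n using Nat.strong_induction_on with
  | _ n ih =>
    rcases n.eq_zero_or_pos with rfl | hn
    · have : ∀ f : Fin 1 → Fin 1, IsParentMap f 0 := fun f =>
        ⟨Subsingleton.elim _ _, fun v => ⟨0, Subsingleton.elim _ _⟩⟩
      simp [parentMapCountRoot, this]
    · have h := abel_identity n 0
      simp only [zero_add] at h
      rw [sum_range_succ'] at h
      have hrec := parentMapCountRoot_rec n
      have hsum : ((n * parentMapCountRoot n : ℕ) : ℚ) = ∑ j ∈ range n,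
          (n.choose (j + 1) : ℚ) * ((j + 1 : ℕ) : ℚ) ^ (j + 1) *
            ((n - (j + 1) : ℕ) + 1 : ℚ) ^ (n - (j + 1) - 1) := by
        rw [hrec]
        push_cast
        refine sum_congr rfl fun m hm => ?_
        have hm' := mem_range.1 hm
        rw [ih m hm', ih (n - (m + 1)) (by lia)]
        push_cast
        have e : (m + 1 : ℚ) ^ 2 * (m + 1) ^ (m - 1) = (m + 1) ^ (m + 1) := by
          cases m with
          | zero => simp
          | succ m => rw [← pow_add]; congr 1; lia
        rw [e]
        ring
      rw [← hsum] at h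
      simp only [Nat.choose_zero_right, Nat.sub_zero, pow_zero, Nat.cast_one, one_mul] at h
      obtain ⟨n, rfl⟩ := Nat.exists_eq_add_of_le' hn
      simp only [Nat.add_sub_cancel, pow_succ] at h ⊢
      have h2 : (((n + 1 : ℕ) : ℚ)) * (parentMapCountRoot (n + 1)) =
          ((n + 1 : ℕ) : ℚ) * ((n + 1 : ℕ) + 1) ^ n := by
        push_cast at h ⊢
        linear_combination h
      have h3 := mul_left_cancel₀ (by positivity) h2
      exact_mod_cast h3

/-- Both sides count the ways to choose a list of `s` and a set of `j` further elements. -/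
lemma choose_mul_descFactorial (s N j : ℕ) :
    (s + N).choose (s + j) * (s + j).descFactorial s = (s + N).descFactorial s * N.choose j := by
  have h := Nat.choose_mul (n := s + N) (k := s + j) (s := s) (by lia)
  rw [Nat.add_sub_cancel_left, Nat.add_sub_cancel_left] at h
  rw [Nat.descFactorial_eq_factorial_mul_choose, Nat.descFactorial_eq_factorial_mul_choose,
    mul_left_comm, h, mul_assoc]

lemma parentMapCount_succ_succ (n k : ℕ) :
    parentMapCount (Fin (n + 1)) (· = k + 2) = ∑ m ∈ range n, n.choose (m + 1) *
      (parentMapCount (Fin (m + 1)) (· = k + 1) * (m + 1) *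
        parentMapCountRoot (n - (m + 1))) := by
  rw [card_isParentMap_split, card_isParentMap_top_ne n (· = k + 2), sum_range_succ']
  have h1 : Nat.card {f : Fin (n + 1) → Fin (n + 1) //
      (∃ r, IsParentMap f r) ∧ f ⊤ = ⊤ ∧ (parentRecords f).ncard = k + 2} = 0 := by
    refine Nat.card_eq_zero.2 (Or.inl ⟨?_⟩)
    rintro ⟨f, ⟨r, hf⟩, ht, hk⟩
    have := hf.ncard_parentRecords_eq_one_iff.2 (hf.apply_eq_self_iff.1 ht)
    lia
  simp [h1]

/-- The number of parent maps on `n + 1` nodes with `k + 1` records, multiplied by `n + 1`. -/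
lemma parentMapCount_mul (n k : ℕ) :
    (parentMapCount (Fin (n + 1)) (· = k + 1) : ℚ) * (n + 1) =
      (k + 1) * n.descFactorial k * (n + 1) ^ (n - k) := by
  induction k generalizing n with
  | zero =>
    simp only [zero_add]
    rw [parentMapCount_one (Fintype.card_fin _), parentMapCountRoot_eq]
    cases n with
    | zero => simp
    | succ n =>
      simp [pow_succ]
  | succ k ih =>
    -- The recurrence involves the counts multiplied by the number `m + 1` of nodes, as in `ih`.
    rw [parentMapCount_succ_succ]
    push_cast
    simp_rw [ih, parentMapCountRoot_eq]
    rcases lt_or_ge n (k + 1) with hlt | hle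
    · rw [Nat.descFactorial_of_lt hlt, sum_eq_zero]
      · simp
      · intro m hm
        rw [Nat.descFactorial_of_lt (n := m) (k := k) (by have := mem_range.1 hm; lia)]
        simp
    · obtain ⟨N, rfl⟩ := Nat.exists_eq_add_of_le hle
      -- The terms with `m < k` vanish; the others, with `m = k + j`, form Abel's sum at
      -- `x = k + 1`.
      rw [show k + 1 + N = k + (N + 1) by ring, sum_range_add, sum_eq_zero, zero_add]
      · have h := abel_identity_div N (x := (k + 1 : ℚ)) (by positivity)
        have hterm : ∀ j ∈ range (N + 1),
            ((k + (N + 1)).choose (k + j + 1) : ℚ) * ((k + 1) * ((k + j).descFactorial k : ℕ) *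
              (((k + j : ℕ) : ℚ) + 1) ^ (k + j - k) *
                (((k + (N + 1) - (k + j + 1) : ℕ) + 1) ^
                  (k + (N + 1) - (k + j + 1) - 1) : ℕ)) =
            ((k + (N + 1)).descFactorial (k + 1) : ℕ) *
              ((N.choose j : ℚ) * ((k + 1 : ℚ) * (k + 1 + j) ^ j / (k + 1 + j)) *
                ((N - j : ℕ) + 1 : ℚ) ^ (N - j - 1)) := by
          intro j hj
          have hj' : j ≤ N := by simpa [Nat.lt_succ_iff] using hj
          have hc := choose_mul_descFactorial (k + 1) N j
          rw [show k + 1 + N = k + (N + 1) by ring, show k + 1 + j = k + j + 1 by ring,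
            Nat.succ_descFactorial_succ] at hc
          have hc' : ((k + (N + 1)).choose (k + j + 1) : ℚ) *
              ((k + 1 + j) * (k + j).descFactorial k) =
              (k + (N + 1)).descFactorial (k + 1) * N.choose j := by
            rw [← Nat.cast_mul, ← hc]; push_cast; ring
          have hne : (k + 1 + j : ℚ) ≠ 0 := by positivity
          rw [Nat.add_sub_cancel_left, show k + (N + 1) - (k + j + 1) = N - j by lia]
          push_cast
          rw [show (k + j + 1 : ℚ) = k + 1 + j by ring]
          field_simp
          linear_combination hc'
        push_cast at hterm ⊢
        rw [sum_congr rfl hterm, ← mul_sum, h, show k + (N + 1) - (k + 1) = N by lia]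
        have hne : (k + (N + 1) + 1 : ℚ) ≠ 0 := by positivity
        rw [show (k + 1 + (N + 1) : ℚ) = k + (N + 1) + 1 by ring]
        field_simp
      · intro m hm
        rw [Nat.descFactorial_of_lt (mem_range.1 hm)]
        simp

lemma prod_Icc_sub_eq_descFactorial (n k : ℕ) :
    ∏ i ∈ Icc 1 k, (((n + 1 : ℕ) : ℚ) - i) = n.descFactorial k := by
  induction k with
  | zero => simp
  | succ k ih =>
    rw [prod_Icc_succ_top (by lia), ih, Nat.descFactorial_succ]
    rcases lt_or_ge n k with h | h
    · simp [Nat.descFactorial_of_lt h]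
    · push_cast [Nat.cast_sub h]
      ring

lemma parentMapCount_eq (n k : ℕ) (hn : 1 ≤ n) :
    (parentMapCount (Fin n) (· = k) : ℚ) =
      k * (∏ i ∈ Icc 1 (k - 1), ((n : ℚ) - i)) * (n : ℚ) ^ ((n : ℤ) - k - 1) := by
  obtain ⟨n, rfl⟩ := Nat.exists_eq_add_of_le' hn
  cases k with
  | zero => simp [parentMapCount_zero]
  | succ k =>
    have hne : ((n : ℚ) + 1) ≠ 0 := by positivity
    rw [Nat.add_sub_cancel, prod_Icc_sub_eq_descFactorial, ← mul_left_inj' hne,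
      parentMapCount_mul]
    rcases lt_or_ge n k with h | h
    · simp [Nat.descFactorial_of_lt h]
    · obtain ⟨d, rfl⟩ := Nat.exists_eq_add_of_le h
      push_cast at hne ⊢
      rw [show ((k : ℤ) + d + 1 - (k + 1) - 1) = d - 1 by ring, zpow_sub_one₀ hne, zpow_natCast,
        Nat.add_sub_cancel_left]
      field_simp

end Count

theorem mainTheorem5 (n k : ℕ) (hn : 1 ≤ n) :
    (treeRecordNumber n k : ℚ) =
      (k : ℚ) * (∏ i ∈ Finset.Icc 1 (k - 1), ((n : ℚ) - (i : ℚ))) *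
        (n : ℚ) ^ ((n : ℤ) - (k : ℤ) - 1) := by
  rw [treeRecordNumber_eq_parentMapCount, parentMapCount_eq n k hn]
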